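/- Let $n\in\mathbb N$ and let $F:\mathbb R^n\times\mathbb R_{\ge 0}\to 2^{\mathbb R^n}$ be a set-valued map. Intervals are nonempty and contained in $\mathbb R_{\ge 0}$, and suprema are taken in $[0,\infty]$. A function $g$ is *locally absolutely continuous* on an interval $I$ if it is absolutely continuous on each compact interval contained in $I$. For a set $S\subseteq I$, $g$ is *AC$_*$* on $S$ if for each $\varepsilon>0$ there is $\delta>0$ such that $\sum_{i=1}^m\sup_{a,b\in[a_i,b_i]}\|g(b)-g(a)\|<\varepsilon$ for each finite collection of non-overlapping intervals $[a_i,b_i]$ with $a_i,b_i\in S$ and $\sum_{i=1}^m|b_i-a_i|<\delta$; and $g$ is *ACG$_*$* on $I$ if it is continuous on $I$ and $I$ is a countable union of sets on each of which $g$ is AC$_*$. A function $x:I\to\mathbb R^n$ on an interval $I$ is a *classical* (respectively *generalized*) *solution* of the differential inclusion $\dot x\in F(x,t)$ if it is locally absolutely continuous (respectively ACG$_*$) on $I$ and, for almost every $t\in I$, $x$ is differentiable at $t$ with $\dot x(t)\in F(x(t),t)$. A classical (generalized) solution $x:I\to\mathbb R^n$ is *maximal* if there is no classical (generalized) solution $\bar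 x:\bar I\to\mathbb R^n$ with $\bar I\cap I\neq\emptyset$, $\sup\bar I>\sup I$ and $x(t)=\bar x(t)$ for all $t\in I\cap\bar I$. **Lemma.** Let $\mathcal D\subset\mathbb R_{\ge 0}$ have no cluster (accumulation) points in $\mathbb R$, and suppose that $F$ is locally bounded on $\mathcal E=\mathbb R^n\times(\mathbb R_{\ge 0}\setminus\mathcal D)$, i.e. every point of $\mathcal E$ has a neighborhood $U$ in $\mathcal E$ for which $\bigcup_{(z,t)\in U}F(z,t)$ is bounded. Let $x:I\to\mathbb R^n$ be a maximal generalized solution of $\dot x\in F(x,t)$. If $I$ is bounded above or $\mathcal D$ is bounded above (possibly empty), then there is an interval $J\subseteq I$ with $\sup J=\sup I$ such that $x|_J$ is a maximal classical solution of $\dot x\in F(x,t)$; moreover, $J$ has more than one point if $I$ does. -/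

import Mathlib

open Set Filter Topology MeasureTheory

/-- A function is represented by a map on all of `ℝ`; every notion below that refers to an
interval `I` depends only on the values of the map on `I`. A time interval is a nonempty,
possibly degenerate or unbounded, interval contained in `[0, ∞)`. -/
def IsTimeInterval (I : Set ℝ) : Prop :=
  I.OrdConnected ∧ I.Nonempty ∧ I ⊆ Ici 0

/-- The supremum of a set of reals in the extended real line. -/
noncomputable def extSup (S : Set ℝ) : EReal :=
  sSup ((fun t : ℝ => (t : EReal)) '' S)

/-- Local absolute continuity on an interval: absolute continuity on each compact subinterval. -/
def IsLAC {n : ℕ} (g : ℝ → EuclideanSpace ℝ (Fin n)) (I : Set ℝ) : Prop :=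
  ∀ a b : ℝ, a ≤ b → Icc a b ⊆ I → AbsolutelyContinuousOnInterval g a b

/-- Absolute continuity in the restricted sense (AC⋆) on a set `S`. The oscillation
`sup_{s,t ∈ [a i, b i]} ‖g t - g s‖` is the diameter of the image of `[a i, b i]`, taken in
`[0, ∞]` so that an infinite oscillation is not mistaken for a finite one. -/
def IsACStar {n : ℕ} (g : ℝ → EuclideanSpace ℝ (Fin n)) (S : Set ℝ) : Prop :=
  ∀ ε : ℝ, 0 < ε → ∃ δ : ℝ, 0 < δ ∧
    ∀ (m : ℕ) (a b : Fin m → ℝ),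
      (∀ i, a i ∈ S ∧ b i ∈ S ∧ a i ≤ b i) →
      (Pairwise fun i j => Disjoint (Ioo (a i) (b i)) (Ioo (a j) (b j))) →
      ∑ i, (b i - a i) < δ →
      ∑ i, Metric.ediam (g '' Icc (a i) (b i)) < ENNReal.ofReal ε

/-- Generalized absolute continuity in the restricted sense (ACG⋆) on a set `S`. -/
def IsACGStar {n : ℕ} (g : ℝ → EuclideanSpace ℝ (Fin n)) (S : Set ℝ) : Prop :=
  ContinuousOn g S ∧ ∃ P : ℕ → Set ℝ, S = ⋃ k, P k ∧ ∀ k, IsACStar g (P k)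

/-- The inclusion `ẋ ∈ F(x, t)` holds almost everywhere on `I`. -/
def SatisfiesInclusion {n : ℕ}
    (F : EuclideanSpace ℝ (Fin n) → ℝ → Set (EuclideanSpace ℝ (Fin n)))
    (I : Set ℝ) (x : ℝ → EuclideanSpace ℝ (Fin n)) : Prop :=
  ∀ᵐ t ∂(volume.restrict I), ∃ v ∈ F (x t) t, HasDerivWithinAt x v I t

/-- `x` is a classical solution of `ẋ ∈ F(x, t)` on `I`. -/
def IsClassicalSolution {n : ℕ}
    (F : EuclideanSpace ℝ (Fin n) → ℝ → Set (EuclideanSpace ℝ (Fin n)))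
    (I : Set ℝ) (x : ℝ → EuclideanSpace ℝ (Fin n)) : Prop :=
  IsTimeInterval I ∧ IsLAC x I ∧ SatisfiesInclusion F I x

/-- `x` is a generalized solution of `ẋ ∈ F(x, t)` on `I`. -/
def IsGeneralizedSolution {n : ℕ}
    (F : EuclideanSpace ℝ (Fin n) → ℝ → Set (EuclideanSpace ℝ (Fin n)))
    (I : Set ℝ) (x : ℝ → EuclideanSpace ℝ (Fin n)) : Prop :=
  IsTimeInterval I ∧ IsACGStar x I ∧ SatisfiesInclusion F I x

/-- With respect to a notion `Sol` of solution (classical or generalized), `x` on `I` is a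
maximal solution: no solution of the same kind, on an interval that meets `I` and has a larger
supremum, agrees with `x` on the common domain. -/
def IsMaximalSolution {n : ℕ} (Sol : Set ℝ → (ℝ → EuclideanSpace ℝ (Fin n)) → Prop)
    (I : Set ℝ) (x : ℝ → EuclideanSpace ℝ (Fin n)) : Prop :=
  Sol I x ∧ ¬ ∃ (I' : Set ℝ) (x' : ℝ → EuclideanSpace ℝ (Fin n)),
    Sol I' x' ∧ (I' ∩ I).Nonempty ∧ extSup I < extSup I' ∧ EqOn x x' (I ∩ I')

/-- The set-valued map `F` is locally bounded on the set `E` of pairs `(z, t)`. -/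
def LocallyBoundedOn {n : ℕ}
    (F : EuclideanSpace ℝ (Fin n) → ℝ → Set (EuclideanSpace ℝ (Fin n)))
    (E : Set (EuclideanSpace ℝ (Fin n) × ℝ)) : Prop :=
  ∀ p ∈ E, ∃ Q : ℝ, ∀ᶠ q in 𝓝[E] p, ∀ v ∈ F q.1 q.2, ‖v‖ ≤ Q

/-! An ACG⋆ function has Lusin's property: null sets go to null sets. So if its derivative is almost
everywhere bounded by `Q`, the exceptional times contribute nothing to the image, the remaining
times contribute measure at most `Q` times the length, and the intermediate value theorem gives the
mean value inequality. Off `D`, a generalized solution is a continuous curve along which `F` is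
bounded over compact sets of times; hence it is locally Lipschitz, so classical.

Since `D` does not accumulate, a terminal piece of `I` avoids `D` except perhaps at its final time,
and `J` is that piece without its endpoints. Maximality transfers because a classical extension, cut
down to a compact interval, is a generalized one, and continuity recovers agreement at a dropped
final time. -/

variable {n : ℕ}

/-! ### Lusin's property and the mean value inequality for real functions -/

section LusinProperty

/-- A bounded function that is absolutely continuous on `P` maps null subsets of `P` to null
sets. -/
theorem volume_image_eq_zero_of_absolutelyContinuous {f : ℝ → ℝ} {P N : Set ℝ}
    (hac : ∀ ε : ℝ, 0 < ε → ∃ δ : ℝ, 0 < δ ∧ ∀ (m : ℕ) (a b : Fin m → ℝ),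
      (∀ i, a i ∈ P ∧ b i ∈ P ∧ a i ≤ b i) →
      (Pairwise fun i j => Disjoint (Ioo (a i) (b i)) (Ioo (a j) (b j))) →
      ∑ i, (b i - a i) < δ → ∑ i, edist (f (a i)) (f (b i)) ≤ ENNReal.ofReal ε)
    (hb : Bornology.IsBounded (f '' P)) (hNP : N ⊆ P) (hN : volume N = 0) :
    volume (f '' N) = 0 := by
  have key : ∀ ε : ℝ, 0 < ε → volume (f '' N) ≤ 2 * ENNReal.ofReal ε := by
    intro ε hε
    obtain ⟨δ, hδ, h⟩ := hac ε hε
    obtain ⟨U, hNU, hUo, hU⟩ : ∃ U, N ⊆ U ∧ IsOpen U ∧ volume U < ENNReal.ofReal δ :=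
      N.exists_isOpen_lt_of_lt _ (by rw [hN]; exact ENNReal.ofReal_pos.2 hδ)
    -- The components of `U` meeting `N` are disjoint open intervals, hence countably many, of total
    -- length below `δ`.
    set C : Set (Set ℝ) := connectedComponentIn U '' N with hC
    have hCo : ∀ c ∈ C, IsOpen c := by
      rintro _ ⟨y, -, rfl⟩
      exact hUo.connectedComponentIn
    have hCU : ∀ c ∈ C, c ⊆ U := by
      rintro _ ⟨y, -, rfl⟩
      exact connectedComponentIn_subset _ _
    have hCc : ∀ c ∈ C, c.OrdConnected := by
      rintro _ ⟨y, -, rfl⟩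
      exact isPreconnected_connectedComponentIn.ordConnected
    have hCN : ∀ c ∈ C, (N ∩ c).Nonempty := by
      rintro _ ⟨y, hy, rfl⟩
      exact ⟨y, hy, mem_connectedComponentIn (hNU hy)⟩
    have hCd : C.PairwiseDisjoint id := by
      rintro _ ⟨y, -, rfl⟩ _ ⟨z, -, rfl⟩ hne
      rw [Function.onFun, id, id, Set.disjoint_left]
      intro w hw hw'
      exact hne ((connectedComponentIn_eq hw).trans (connectedComponentIn_eq hw').symm)
    have hCcount : C.Countable :=
      hCd.countable_of_isOpen hCo fun c hc => (hCN c hc).mono inter_subset_right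
    have : Countable C := hCcount.to_subtype
    -- The diameter over `N ∩ c` need not be attained; a factor 2 buys a pair of points of `N`.
    -- Boundedness on `P` makes half a positive diameter strictly smaller than the diameter.
    have hpair : ∀ c : C, ∃ s ∈ N ∩ c, ∃ t ∈ N ∩ c, s ≤ t ∧
        Metric.ediam (f '' (N ∩ c)) ≤ 2 * edist (f s) (f t) := by
      intro c
      by_contra! hcon
      obtain ⟨y, hy⟩ := hCN c c.2
      have hpos : 0 < Metric.ediam (f '' (N ∩ c)) := by
        simpa using hcon y hy y hy le_rfl
      have hfin : Metric.ediam (f '' (N ∩ c)) ≠ ⊤ :=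
        (hb.subset (image_mono (inter_subset_left.trans hNP))).ediam_ne_top
      refine absurd (ENNReal.half_lt_self hpos.ne' hfin) (not_lt.2 ?_)
      refine Metric.ediam_image_le_iff.2 fun s hs t ht => ?_
      rw [ENNReal.le_div_iff_mul_le (by simp) (by simp), mul_comm]
      rcases le_total s t with hst | hst
      · exact (hcon s hs t ht hst).le
      · rw [edist_comm]
        exact (hcon t ht s hs hst).le
    choose s hs t ht hst hdiam using hpair
    have hsub : f '' N ⊆ ⋃ c : C, f '' (N ∩ c) := by
      rintro _ ⟨y, hy, rfl⟩
      exact mem_iUnion.2 ⟨⟨_, y, hy, rfl⟩, y, ⟨hy, mem_connectedComponentIn (hNU hy)⟩, rfl⟩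
    have hIoo : ∀ c : C, Ioo (s c) (t c) ⊆ c := fun c =>
      Ioo_subset_Icc_self.trans ((hCc c c.2).out (hs c).2 (ht c).2)
    calc volume (f '' N) ≤ ∑' c : C, volume (f '' (N ∩ c)) :=
          (measure_mono hsub).trans (measure_iUnion_le _)
      _ ≤ ∑' c : C, 2 * edist (f (s c)) (f (t c)) :=
          ENNReal.tsum_le_tsum fun c => (Real.volume_le_diam _).trans (hdiam c)
      _ = 2 * ∑' c : C, edist (f (s c)) (f (t c)) := ENNReal.tsum_mul_left
      _ ≤ 2 * ENNReal.ofReal ε := by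
        gcongr
        -- Absolute continuity concerns finite families, so it is applied to each finite partial
        -- sum.
        rw [ENNReal.tsum_eq_iSup_sum]
        refine iSup_le fun A => ?_
        have hsum : ∀ {M : Type} [AddCommMonoid M] (g : C → M),
            ∑ i, g (A.equivFin.symm i) = ∑ c ∈ A, g c := fun g => by
          rw [← A.sum_coe_sort]
          exact A.equivFin.symm.sum_comp fun c : A => g c
        rw [← hsum fun c => edist (f (s c)) (f (t c))]
        have hd : Pairwise fun c c' : C => Disjoint (c : Set ℝ) c' := fun c c' hcc =>
          hCd c.2 c'.2 (Subtype.coe_injective.ne hcc)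
        refine h _ (fun i => s (A.equivFin.symm i)) (fun i => t (A.equivFin.symm i))
          (fun i => ⟨hNP (hs _).1, hNP (ht _).1, hst _⟩) (fun i j hij => ?_) ?_
        · refine (hd ?_).mono (hIoo _) (hIoo _)
          exact Subtype.coe_injective.ne (A.equivFin.symm.injective.ne hij)
        · rw [hsum fun c => t c - s c, ← ENNReal.ofReal_lt_ofReal_iff hδ]
          refine lt_of_le_of_lt ?_ hU
          rw [ENNReal.ofReal_sum_of_nonneg fun c _ => sub_nonneg.2 (hst c)]
          simp_rw [← Real.volume_Ioo]
          rw [← measure_biUnion_finset (fun c _ c' _ hcc => (hd hcc).mono (hIoo c) (hIoo c'))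
            fun c _ => measurableSet_Ioo]
          exact measure_mono (iUnion₂_subset fun c _ => (hIoo c).trans (hCU c c.2))
  refine le_antisymm (ENNReal.le_of_forall_pos_le_add fun ε hε _ => ?_) bot_le
  have h2 := key (ε / 2) (by positivity)
  rw [zero_add]
  refine h2.trans_eq ?_
  rw [← ENNReal.ofReal_ofNat, ← ENNReal.ofReal_mul (by norm_num), mul_div_cancel₀ _ (by norm_num),
    ENNReal.ofReal_coe_nnreal]

/-- A continuous function with Lusin's property whose derivative is almost everywhere bounded by
`Q` satisfies the mean value inequality. -/
theorem edist_le_of_lusin_of_ae_hasDerivWithinAt {f : ℝ → ℝ} {a b : ℝ} {Q : ENNReal} (hab : a ≤ b)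
    (hc : ContinuousOn f (Icc a b))
    (hlusin : ∀ N ⊆ Icc a b, volume N = 0 → volume (f '' N) = 0)
    (hd : ∀ᵐ t ∂(volume.restrict (Icc a b)),
      ∃ v, ‖v‖ₑ ≤ Q ∧ HasDerivWithinAt f v (Icc a b) t) :
    edist (f a) (f b) ≤ Q * ENNReal.ofReal (b - a) := by
  obtain ⟨N, hbad, hNm, hN⟩ := exists_measurable_superset_of_null hd
  rw [Measure.restrict_apply hNm] at hN
  have hgood : ∀ t ∉ N, ∃ v, ‖v‖ₑ ≤ Q ∧ HasDerivWithinAt f v (Icc a b) t := fun t ht => by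
    by_contra hcon
    exact ht (hbad hcon)
  choose! v hv hder using hgood
  have himage : volume (f '' (Icc a b \ N)) ≤ Q * ENNReal.ofReal (b - a) := by
    refine (addHaar_image_le_lintegral_abs_det_fderiv volume (measurableSet_Icc.diff hNm)
      fun t ht => ((hder t ht.2).mono sdiff_subset).hasFDerivWithinAt).trans ?_
    calc _ ≤ ∫⁻ _ in Icc a b \ N, Q := by
          refine setLIntegral_mono' (measurableSet_Icc.diff hNm) fun t ht => ?_
          rw [ContinuousLinearMap.det_toSpanSingleton, ← Real.enorm_eq_ofReal_abs]
          exact hv t ht.2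
      _ ≤ Q * ENNReal.ofReal (b - a) := by
          rw [setLIntegral_const, ← Real.volume_Icc]
          gcongr
          exact sdiff_subset
  calc edist (f a) (f b) = volume (uIcc (f a) (f b)) := by
        rw [Real.volume_interval, edist_comm, edist_dist, Real.dist_eq]
    _ ≤ volume (f '' Icc a b) := by
        have := intermediate_value_uIcc (f := f) (a := a) (b := b) (by rwa [uIcc_of_le hab])
        rw [uIcc_of_le hab] at this
        exact measure_mono this
    _ ≤ volume (f '' (N ∩ Icc a b)) + volume (f '' (Icc a b \ N)) := by
        refine (measure_mono ?_).trans (measure_union_le _ _)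
        rw [← image_union, inter_comm, inter_union_sdiff]
    _ ≤ Q * ENNReal.ofReal (b - a) := by
        rw [hlusin _ inter_subset_right hN, zero_add]
        exact himage

end LusinProperty

/-! ### From ACG⋆ to absolute continuity under a derivative bound, and back -/

section ACStar

variable {g : ℝ → EuclideanSpace ℝ (Fin n)}

theorem IsACStar.mono {S S' : Set ℝ} (h : IsACStar g S) (hS : S' ⊆ S) : IsACStar g S' := by
  intro ε hε
  obtain ⟨δ, hδ, h⟩ := h ε hε
  exact ⟨δ, hδ, fun m a b hab => h m a b fun i => ⟨hS (hab i).1, hS (hab i).2.1, (hab i).2.2⟩⟩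

theorem IsACGStar.mono {S S' : Set ℝ} (h : IsACGStar g S) (hS : S' ⊆ S) : IsACGStar g S' := by
  obtain ⟨hc, P, rfl, hP⟩ := h
  refine ⟨hc.mono hS, fun k => S' ∩ P k, ?_, fun k => (hP k).mono inter_subset_right⟩
  rw [← inter_iUnion, inter_eq_left.2 hS]

/-- The composition of a nonexpansive function with an ACG⋆ function has Lusin's property on
compact intervals. -/
theorem IsACGStar.volume_image_eq_zero {a b : ℝ} (h : IsACGStar g (Icc a b))
    {φ : EuclideanSpace ℝ (Fin n) → ℝ} (hφ : LipschitzWith 1 φ) {N : Set ℝ} (hN : N ⊆ Icc a b)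
    (hN0 : volume N = 0) : volume ((φ ∘ g) '' N) = 0 := by
  obtain ⟨hc, P, hP, hac⟩ := h
  have hNP : N = ⋃ k, N ∩ P k := by rw [← inter_iUnion, ← hP, inter_eq_left.2 hN]
  rw [hNP, image_iUnion]
  refine measure_iUnion_null fun k => ?_
  refine volume_image_eq_zero_of_absolutelyContinuous (P := P k) ?_ ?_ inter_subset_right
    (measure_mono_null inter_subset_left hN0)
  · intro ε hε
    obtain ⟨δ, hδ, h⟩ := hac k ε hε
    refine ⟨δ, hδ, fun m c d hcd hdisj hlen => le_trans ?_ (h m c d hcd hdisj hlen).le⟩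
    refine Finset.sum_le_sum fun i _ => ?_
    refine (hφ.edist_le_mul _ _).trans ?_
    rw [ENNReal.coe_one, one_mul]
    exact Metric.edist_le_ediam_of_mem (mem_image_of_mem _ (left_mem_Icc.2 (hcd i).2.2))
      (mem_image_of_mem _ (right_mem_Icc.2 (hcd i).2.2))
  · have hcomp : IsCompact ((φ ∘ g) '' Icc a b) :=
      isCompact_Icc.image_of_continuousOn (hφ.continuous.comp_continuousOn hc)
    refine hcomp.isBounded.subset (image_mono ?_)
    rw [hP]
    exact subset_iUnion P k

/-- An ACG⋆ function with almost everywhere bounded derivative satisfies the mean value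
inequality. -/
theorem IsACGStar.norm_sub_le {a b Q : ℝ} (hQ : 0 ≤ Q) (hab : a ≤ b) (h : IsACGStar g (Icc a b))
    (hd : ∀ᵐ t ∂(volume.restrict (Icc a b)),
      ∃ v, ‖v‖ ≤ Q ∧ HasDerivWithinAt g v (Icc a b) t) :
    ‖g b - g a‖ ≤ Q * (b - a) := by
  -- A functional norming the increment reduces the claim to a real function.
  obtain ⟨φ, hφ, hφg⟩ := exists_dual_vector'' ℝ (g b - g a)
  have hlip : LipschitzWith 1 φ := φ.lipschitz.weaken (by exact_mod_cast hφ)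
  have key : edist ((φ ∘ g) a) ((φ ∘ g) b) ≤ ENNReal.ofReal Q * ENNReal.ofReal (b - a) := by
    refine edist_le_of_lusin_of_ae_hasDerivWithinAt hab (hlip.continuous.comp_continuousOn h.1)
      (fun N hN hN0 => h.volume_image_eq_zero hlip hN hN0) ?_
    filter_upwards [hd] with t ⟨v, hv, hder⟩
    refine ⟨φ v, ?_, φ.hasFDerivAt.comp_hasDerivWithinAt t hder⟩
    rw [← ofReal_norm]
    refine ENNReal.ofReal_le_ofReal ((φ.le_opNorm v).trans ?_)
    exact (mul_le_of_le_one_left (norm_nonneg v) hφ).trans hv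
  rw [← ENNReal.ofReal_mul hQ, edist_dist, dist_comm, Real.dist_eq, Function.comp, Function.comp,
    ← map_sub, hφg, ENNReal.ofReal_le_ofReal_iff (mul_nonneg hQ (sub_nonneg.2 hab))] at key
  simpa using key

/-- The mean value inequality on every subinterval makes `g` Lipschitz with constant `Q`. -/
theorem IsACGStar.absolutelyContinuousOnInterval {a b Q : ℝ} (hQ : 0 ≤ Q) (hab : a ≤ b)
    (h : IsACGStar g (Icc a b))
    (hd : ∀ᵐ t ∂(volume.restrict (Icc a b)),
      ∃ v, ‖v‖ ≤ Q ∧ HasDerivWithinAt g v (Icc a b) t) :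
    AbsolutelyContinuousOnInterval g a b := by
  refine LipschitzOnWith.absolutelyContinuousOnInterval (K := Q.toNNReal) ?_
  rw [uIcc_of_le hab]
  have hle : ∀ s ∈ Icc a b, ∀ t ∈ Icc a b, s ≤ t → ‖g t - g s‖ ≤ Q * (t - s) := by
    intro s hs t ht hst
    have hsub : Icc s t ⊆ Icc a b := Icc_subset_Icc hs.1 ht.2
    refine (h.mono hsub).norm_sub_le hQ hst ?_
    filter_upwards [ae_restrict_of_ae_restrict_of_subset hsub hd] with r ⟨v, hv, hder⟩
    exact ⟨v, hv, hder.mono hsub⟩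
  refine LipschitzOnWith.of_dist_le_mul fun s hs t ht => ?_
  rw [Real.coe_toNNReal Q hQ]
  rcases le_total s t with hst | hst
  · rw [dist_comm, dist_comm s, dist_eq_norm, Real.dist_eq, abs_of_nonneg (sub_nonneg.2 hst)]
    exact hle s hs t ht hst
  · rw [dist_eq_norm, Real.dist_eq, abs_of_nonneg (sub_nonneg.2 hst)]
    exact hle t ht s hs hst

/-- On a compact interval, absolute continuity implies its restricted form. -/
theorem AbsolutelyContinuousOnInterval.isACStar {p q : ℝ} (hpq : p ≤ q)
    (h : AbsolutelyContinuousOnInterval g p q) : IsACStar g (Icc p q) := by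
  have hcont : ContinuousOn g (Icc p q) := by
    simpa only [uIcc_of_le hpq] using h.continuousOn
  rw [absolutelyContinuousOnInterval_iff] at h
  intro ε hε
  obtain ⟨δ, hδ, h⟩ := h ε hε
  refine ⟨δ, hδ, fun m a b hab hdisj hlen => ?_⟩
  have hsub : ∀ i, Icc (a i) (b i) ⊆ Icc p q := fun i =>
    Icc_subset_Icc (hab i).1.1 (hab i).2.1.2
  -- By compactness each oscillation is attained at a pair `s ≤ t`, so ordinary absolute continuity
  -- applied to the shorter intervals `[s i, t i]` suffices.
  have hmax : ∀ i, ∃ s ∈ Icc (a i) (b i), ∃ t ∈ Icc (a i) (b i), s ≤ t ∧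
      Metric.ediam (g '' Icc (a i) (b i)) ≤ ENNReal.ofReal (dist (g s) (g t)) := by
    intro i
    have hne : (Icc (a i) (b i)).Nonempty := nonempty_Icc.2 (hab i).2.2
    have hci := hcont.mono (hsub i)
    have hdist : ContinuousOn (fun z : ℝ × ℝ => dist (g z.1) (g z.2))
        (Icc (a i) (b i) ×ˢ Icc (a i) (b i)) :=
      continuous_dist.comp_continuousOn ((hci.comp continuousOn_fst fun z hz => hz.1).prodMk
        (hci.comp continuousOn_snd fun z hz => hz.2))
    obtain ⟨⟨s, t⟩, ⟨hs, ht⟩, hst⟩ :=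
      (isCompact_Icc.prod isCompact_Icc).exists_isMaxOn (hne.prod hne) hdist
    have hd : Metric.ediam (g '' Icc (a i) (b i)) ≤ ENNReal.ofReal (dist (g s) (g t)) := by
      refine Metric.ediam_image_le_iff.2 fun y hy z hz => ?_
      rw [edist_dist]
      exact ENNReal.ofReal_le_ofReal (isMaxOn_iff.1 hst (y, z) ⟨hy, hz⟩)
    rcases le_total s t with hle | hle
    · exact ⟨s, hs, t, ht, hle, hd⟩
    · exact ⟨t, ht, s, hs, hle, by rwa [dist_comm]⟩
  choose s hs t ht hst hdiam using hmax
  let E : ℕ → ℝ × ℝ := fun i => if hi : i < m then (s ⟨i, hi⟩, t ⟨i, hi⟩) else (0, 0)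
  have hE : ∀ i : Fin m, E i = (s i, t i) := fun i => by simp [E]
  have hE' : ∀ {i} (hi : i < m), E i = (s ⟨i, hi⟩, t ⟨i, hi⟩) := fun hi => by simp [E, hi]
  have hmem : (m, E) ∈ AbsolutelyContinuousOnInterval.disjWithin p q := by
    refine ⟨fun i hi => ?_, fun i hi j hj hij => ?_⟩
    · rw [Finset.mem_range] at hi
      simp only at hi
      rw [uIcc_of_le hpq]
      simp only [hE' hi]
      exact ⟨hsub _ (hs _), hsub _ (ht _)⟩
    · simp only [Finset.coe_range, mem_Iio] at hi hj
      have hd := hdisj (i := ⟨i, hi⟩) (j := ⟨j, hj⟩) (by simpa using hij)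
      simp only [Function.onFun, hE' hi, hE' hj]
      rw [uIoc_of_le (hst _), uIoc_of_le (hst _)]
      simp only [Ioo_disjoint_Ioo] at hd
      refine Disjoint.mono (Ioc_subset_Ioc (hs _).1 (ht _).2) (Ioc_subset_Ioc (hs _).1 (ht _).2) ?_
      rwa [Ioc_disjoint_Ioc]
  have hfin := h (m, E) hmem (by
    rw [← Fin.sum_univ_eq_sum_range (fun i => dist (E i).1 (E i).2)]
    simp only [hE]
    refine lt_of_le_of_lt (Finset.sum_le_sum fun i _ => ?_) hlen
    rw [dist_comm, Real.dist_eq, abs_of_nonneg (sub_nonneg.2 (hst i))]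
    exact sub_le_sub (ht i).2 (hs i).1)
  rw [← Fin.sum_univ_eq_sum_range (fun i => dist (g (E i).1) (g (E i).2))] at hfin
  simp only [hE] at hfin
  refine lt_of_le_of_lt (Finset.sum_le_sum fun i _ => hdiam i) ?_
  rw [← ENNReal.ofReal_sum_of_nonneg fun i _ => dist_nonneg]
  exact (ENNReal.ofReal_lt_ofReal_iff hε).2 hfin

theorem AbsolutelyContinuousOnInterval.isACGStar {p q : ℝ} (hpq : p ≤ q)
    (h : AbsolutelyContinuousOnInterval g p q) : IsACGStar g (Icc p q) :=
  ⟨by simpa only [uIcc_of_le hpq] using h.continuousOn, fun _ => Icc p q, (iUnion_const _).symm,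
    fun _ => h.isACStar hpq⟩

end ACStar

/-! ### Solutions, maximality and the terminal piece -/

section Solutions

variable {F : EuclideanSpace ℝ (Fin n) → ℝ → Set (EuclideanSpace ℝ (Fin n))}
  {I J : Set ℝ} {x : ℝ → EuclideanSpace ℝ (Fin n)}

theorem SatisfiesInclusion.mono (h : SatisfiesInclusion F I x) (hJ : J ⊆ I) :
    SatisfiesInclusion F J x := by
  filter_upwards [ae_restrict_of_ae_restrict_of_subset hJ h] with t ⟨v, hv, hder⟩
  exact ⟨v, hv, hder.mono hJ⟩

/-- A classical solution restricts to a generalized one on each compact subinterval. -/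
theorem IsClassicalSolution.isGeneralizedSolution_Icc (h : IsClassicalSolution F I x) {p q : ℝ}
    (hp : p ∈ I) (hq : q ∈ I) (hpq : p ≤ q) : IsGeneralizedSolution F (Icc p q) x := by
  obtain ⟨⟨hI, -, hI0⟩, hac, hin⟩ := h
  have hsub : Icc p q ⊆ I := hI.out hp hq
  exact ⟨⟨ordConnected_Icc, nonempty_Icc.2 hpq, hsub.trans hI0⟩,
    (hac p q hpq hsub).isACGStar hpq, hin.mono hsub⟩

/-- Along a continuous curve over a compact set of times, a locally bounded map is bounded. -/
theorem LocallyBoundedOn.exists_bound {E : Set (EuclideanSpace ℝ (Fin n) × ℝ)}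
    (hF : LocallyBoundedOn F E) {K : Set ℝ} (hK : IsCompact K) (hx : ContinuousOn x K)
    (hKE : ∀ t ∈ K, (x t, t) ∈ E) : ∃ Q : ℝ, 0 ≤ Q ∧ ∀ t ∈ K, ∀ v ∈ F (x t) t, ‖v‖ ≤ Q := by
  refine hK.induction_on (p := fun K => ∃ Q : ℝ, 0 ≤ Q ∧ ∀ t ∈ K, ∀ v ∈ F (x t) t, ‖v‖ ≤ Q)
    ⟨0, le_rfl, by simp⟩ (fun s t hst ⟨Q, hQ, h⟩ => ⟨Q, hQ, fun r hr => h r (hst hr)⟩) ?_ ?_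
  · rintro s t ⟨Q, hQ, h⟩ ⟨Q', -, h'⟩
    refine ⟨max Q Q', hQ.trans (le_max_left _ _), ?_⟩
    rintro r (hr | hr) v hv
    · exact (h r hr v hv).trans (le_max_left _ _)
    · exact (h' r hr v hv).trans (le_max_right _ _)
  · intro t ht
    obtain ⟨Q, hQ⟩ := hF _ (hKE t ht)
    have hlim : Tendsto (fun s => (x s, s)) (𝓝[K] t) (𝓝[E] (x t, t)) :=
      tendsto_nhdsWithin_of_tendsto_nhds_of_eventually_within _
        ((hx.prodMk continuousOn_id) t ht)
        (eventually_mem_nhdsWithin.mono hKE)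
    exact ⟨_, hlim.eventually hQ, max Q 0, le_max_right _ _,
      fun s hs v hv => (hs v hv).trans (le_max_left _ _)⟩

/-- Away from the exceptional times a generalized solution is a classical one. -/
theorem IsGeneralizedSolution.isClassicalSolution {D : Set ℝ}
    (hF : LocallyBoundedOn F (univ ×ˢ (Ici 0 \ D))) (h : IsGeneralizedSolution F I x)
    (hID : Disjoint I D) : IsClassicalSolution F I x := by
  obtain ⟨hI, hac, hin⟩ := h
  refine ⟨hI, fun a b hab hsub => ?_, hin⟩
  obtain ⟨Q, hQ, hbound⟩ := hF.exists_bound isCompact_Icc (hac.1.mono hsub) fun t ht =>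
    ⟨mem_univ _, hI.2.2 (hsub ht), disjoint_left.1 hID (hsub ht)⟩
  refine (hac.mono hsub).absolutelyContinuousOnInterval hQ hab ?_
  filter_upwards [hin.mono hsub, ae_restrict_mem measurableSet_Icc] with t ⟨v, hv, hder⟩ ht
  exact ⟨v, hbound t ht v hv, hder⟩

/-- A classical restriction of a maximal generalized solution to a terminal piece of its domain,
possibly without the final time, is a maximal classical solution. -/
theorem IsMaximalSolution.isMaximalSolution_classical
    (hx : IsMaximalSolution (IsGeneralizedSolution F) I x) (hJI : J ⊆ I)
    (hsup : extSup J = extSup I)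
    (hend : ∀ p ∈ J, ∀ t ∈ I, p ≤ t → t ∈ J ∨ p < t ∧ Ico p t ⊆ J)
    (hJ : IsClassicalSolution F J x) : IsMaximalSolution (IsClassicalSolution F) J x := by
  refine ⟨hJ, ?_⟩
  rintro ⟨I', x', hx', ⟨p, hpI', hpJ⟩, hlt, heq⟩
  rw [hsup] at hlt
  -- The extension lives at some time `q` beyond all of `I`; its restriction to `[p, q]` contradicts
  -- generalized maximality.
  obtain ⟨_, ⟨q, hq, rfl⟩, hIq⟩ := lt_sSup_iff.1 hlt
  have hle : ∀ t ∈ I, t < q := fun t ht =>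
    EReal.coe_lt_coe_iff.1 ((le_sSup (mem_image_of_mem _ ht)).trans_lt hIq)
  have hpq : p < q := hle p (hJI hpJ)
  have hgen := hx'.isGeneralizedSolution_Icc hpI' hq hpq.le
  have hsub : Icc p q ⊆ I' := hx'.1.1.out hpI' hq
  refine hx.2 ⟨Icc p q, x', hgen, ⟨p, left_mem_Icc.2 hpq.le, hJI hpJ⟩,
    hIq.trans_le (le_sSup (mem_image_of_mem _ (right_mem_Icc.2 hpq.le))), ?_⟩
  rintro t ⟨htI, htq⟩
  rcases hend p hpJ t htI htq.1 with htJ | ⟨hpt, hIco⟩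
  · exact heq ⟨htJ, hsub htq⟩
  · have hIcc : Icc p t ⊆ I := hx.1.1.1.out (hJI hpJ) htI
    have hIcc' : Icc p t ⊆ Icc p q := Icc_subset_Icc_right htq.2
    have hEqIco : EqOn x x' (Ico p t) := fun s hs =>
      heq ⟨hIco hs, hsub (hIcc' (Ico_subset_Icc_self hs))⟩
    exact hEqIco.of_subset_closure (hx.1.2.1.1.mono hIcc) (hgen.2.1.1.mono hIcc')
      Ico_subset_Icc_self (by rw [closure_Ico hpt.ne]) (right_mem_Icc.2 hpt.le)

/-- A nontrivial interval has a terminal piece whose non-final times avoid a set without cluster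
points, if the interval or the set is bounded above. -/
theorem exists_forall_notMem_of_forall_not_accPt {D : Set ℝ} (hI : I.OrdConnected)
    (hnt : I.Nontrivial) (hcluster : ∀ t : ℝ, ¬ AccPt t (𝓟 D)) (hfin : BddAbove I ∨ BddAbove D) :
    ∃ c ∈ I, (∃ r ∈ I, c < r) ∧ ∀ t ∈ I, c < t → (∃ s ∈ I, t < s) → t ∉ D := by
  by_cases hb : BddAbove I
  · obtain ⟨p, hp, q, hq, hpq⟩ := hnt.exists_lt
    have hacc := hcluster (sSup I)
    rw [accPt_iff_frequently, not_frequently] at hacc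
    have hpT : p < sSup I := hpq.trans_le (le_csSup hb hq)
    obtain ⟨l, hl, hlD⟩ := exists_Ioc_subset_of_mem_nhds hacc ⟨p, hpT⟩
    obtain ⟨r, hr, hcr⟩ := exists_lt_of_lt_csSup hnt.nonempty (max_lt hpT hl)
    -- Past `l` only `sSup I` itself can lie in `D`; taking the maximum with `p` keeps `c` in `I`.
    refine ⟨max p l, hI.out hp hr ⟨le_max_left _ _, hcr.le⟩, ⟨r, hr, hcr⟩, ?_⟩
    rintro t - hct ⟨s, hs, hts⟩ htD
    have htT : t < sSup I := hts.trans_le (le_csSup hb hs)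
    exact hlD ⟨(le_max_right _ _).trans_lt hct, htT.le⟩ ⟨htT.ne, htD⟩
  · obtain ⟨M, hM⟩ := hfin.resolve_left hb
    obtain ⟨c, hc, hMc⟩ := not_bddAbove_iff.1 hb M
    exact ⟨c, hc, not_bddAbove_iff.1 hb c, fun t _ hct _ htD =>
      absurd (hM htD) (not_le.2 (hMc.trans hct))⟩

/-- A dropped final time is still approached from below by points beyond `c`, so the supremum
survives. -/
theorem extSup_setOf_lt {c r : ℝ} (hI : I.OrdConnected) (hc : c ∈ I) (hr : r ∈ I) (hcr : c < r) :
    extSup {t | t ∈ I ∧ c < t ∧ ∃ s ∈ I, t < s} = extSup I := by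
  refine le_antisymm (sSup_le_sSup (image_mono fun t ht => ht.1)) (sSup_le ?_)
  rintro _ ⟨t, ht, rfl⟩
  obtain ⟨u, hu, htu, hcu⟩ : ∃ u ∈ I, t ≤ u ∧ c < u := by
    rcases le_total t r with h | h
    · exact ⟨r, hr, h, hcr⟩
    · exact ⟨t, ht, le_rfl, hcr.trans_le h⟩
  refine (EReal.coe_le_coe_iff.2 htu).trans (le_of_forall_lt fun z hz => ?_)
  obtain ⟨y, hy, hyu⟩ := EReal.lt_iff_exists_real_btwn.1
    (max_lt hz (EReal.coe_lt_coe_iff.2 hcu))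
  have hcy : c < y := EReal.coe_lt_coe_iff.1 ((le_max_right _ _).trans_lt hy)
  have hyu' : y < u := EReal.coe_lt_coe_iff.1 hyu
  refine ((le_max_left _ _).trans_lt hy).trans_le (le_sSup (mem_image_of_mem _ ?_))
  exact ⟨hI.out hc hu ⟨hcy.le, hyu'.le⟩, hcy, u, hu, hyu'⟩

end Solutions

theorem mainTheorem3 {n : ℕ}
    (F : EuclideanSpace ℝ (Fin n) → ℝ → Set (EuclideanSpace ℝ (Fin n)))
    (D : Set ℝ) (hD : D ⊆ Ici 0)
    (hcluster : ∀ t : ℝ, ¬ AccPt t (𝓟 D))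
    (hF : LocallyBoundedOn F (univ ×ˢ (Ici 0 \ D)))
    (I : Set ℝ) (x : ℝ → EuclideanSpace ℝ (Fin n))
    (hx : IsMaximalSolution (IsGeneralizedSolution F) I x)
    (hfin : BddAbove I ∨ BddAbove D) :
    ∃ J : Set ℝ, J ⊆ I ∧ (I.Nontrivial → J.Nontrivial) ∧ extSup J = extSup I ∧
      IsMaximalSolution (IsClassicalSolution F) J x := by
  obtain ⟨⟨hI, hIne, hI0⟩, hac, hin⟩ := hx.1
  -- A one-point `I` must be kept whole: removing endpoints would leave nothing.
  rcases I.subsingleton_or_nontrivial with hsub | hnt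
  · refine ⟨I, subset_rfl, id, rfl, hx.isMaximalSolution_classical subset_rfl rfl
      (fun p _ t ht _ => Or.inl ht) ⟨hx.1.1, fun a b hab hIcc => ?_, hin⟩⟩
    obtain rfl : a = b := hsub (hIcc (left_mem_Icc.2 hab)) (hIcc (right_mem_Icc.2 hab))
    refine LipschitzOnWith.absolutelyContinuousOnInterval (K := 0) ?_
    simp
  obtain ⟨c, hc, ⟨r, hr, hcr⟩, hcD⟩ :=
    exists_forall_notMem_of_forall_not_accPt hI hnt hcluster hfin
  -- Both `c` and a possible final time are excluded, since either may belong to `D`.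
  set J : Set ℝ := {t | t ∈ I ∧ c < t ∧ ∃ s ∈ I, t < s} with hJ
  have hJI : J ⊆ I := fun t ht => ht.1
  have hIoo : ∀ u ∈ I, Ioo c u ⊆ J := fun u hu t ht =>
    ⟨hI.out hc hu ⟨ht.1.le, ht.2.le⟩, ht.1, u, hu, ht.2⟩
  have hsup : extSup J = extSup I := extSup_setOf_lt hI hc hr hcr
  have hJnt : J.Nontrivial := (Ioo_infinite hcr).nontrivial.mono (hIoo r hr)
  have hJord : J.OrdConnected := by
    refine ⟨fun s hs t ht u hu => ?_⟩
    obtain ⟨v, hv, htv⟩ := ht.2.2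
    exact hIoo v hv ⟨hs.2.1.trans_le hu.1, hu.2.trans_lt htv⟩
  refine ⟨J, hJI, fun _ => hJnt, hsup, hx.isMaximalSolution_classical hJI hsup ?_ ?_⟩
  · intro p hp t ht hpt
    rcases hpt.eq_or_lt with rfl | hpt
    · exact Or.inl hp
    · exact Or.inr ⟨hpt, fun s hs => hIoo t ht ⟨hp.2.1.trans_le hs.1, hs.2⟩⟩
  · have hgen : IsGeneralizedSolution F J x :=
      ⟨⟨hJord, hJnt.nonempty, hJI.trans hI0⟩, hac.mono hJI, hin.mono hJI⟩
    exact hgen.isClassicalSolution hF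
      (disjoint_left.2 fun t ht => hcD t ht.1 ht.2.1 ht.2.2)
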